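/- A Seidel matrix of order $n$ is a real symmetric $n\times n$ matrix $S$ with zero diagonal and all off-diagonal entries equal to $\pm1$. Its graph $G(S)$ has vertex set $\{1,\dots,n\}$, with $i\sim j$ if and only if $S_{ij}=-1$. For $U\subseteq\{1,\dots,n\}$ let $D_U$ be the diagonal matrix with $(D_U)_{ii}=1$ for $i\in U$ and $(D_U)_{ii}=-1$ for $i\notin U$; the switching class $[S]$ of $S$ is the set of all graphs $G(D_USD_U)$, $U\subseteq\{1,\dots,n\}$. The independence number $\alpha([S])$ of the switching class is the independence number of the switching graph $G\left(\begin{smallmatrix}S & -S+\mathbf I\\ -S+\mathbf I & S\end{smallmatrix}\right)$ on $2n$ vertices (for $n\ge 2$ this equals the largest independence number of a graph in $[S]$). Theorem. Let $S$ be a Seidel matrix of order $n\ge 277$ with smallest eigenvalue $\lambda_{\min}(S)=-5$, and suppose that $\alpha([S])\ge 49$. Then $$\operatorname{rk}(S+5\mathbf I)\ \ge\ \frac{2n}{3}+1 .$$ Moreover, some graph in the switching class $[S]$ has maximum valency at most $6$. -/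

import Mathlib

namespace SeidelMatrix

variable {V : Type*} [DecidableEq V]

/-- A Seidel matrix: a real symmetric matrix with zero diagonal, all of whose off-diagonal
entries are `1` or `-1`. -/
structure IsSeidel (S : Matrix V V ℝ) : Prop where
  symm : S.IsSymm
  diag : ∀ i, S i i = 0
  offDiag : ∀ i j, i ≠ j → S i j = 1 ∨ S i j = -1

/-- The graph corresponding to a Seidel matrix: `i` and `j` are adjacent iff `S i j = -1`. -/
def graph (S : Matrix V V ℝ) (hS : IsSeidel S) : SimpleGraph V where
  Adj i j := S i j = -1
  symm := ⟨fun i j h => (hS.symm.apply i j).trans h⟩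
  loopless := ⟨fun i h => by simp [hS.diag i] at h⟩

open Classical in
/-- The diagonal matrix `D_U`, with entry `1` at the elements of `U` and `-1` elsewhere. -/
noncomputable def signMatrix (U : Set V) : Matrix V V ℝ :=
  Matrix.diagonal fun i => if i ∈ U then 1 else -1

/-- The Seidel matrix obtained from `S` by switching with respect to `U`. -/
noncomputable def switch [Fintype V] (S : Matrix V V ℝ) (U : Set V) : Matrix V V ℝ :=
  signMatrix U * S * signMatrix U

theorem IsSeidel.switch [Fintype V] {S : Matrix V V ℝ} (hS : IsSeidel S) (U : Set V) :
    IsSeidel (switch S U) where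
  symm := by
    ext i j
    simp only [SeidelMatrix.switch, signMatrix, Matrix.transpose_apply, Matrix.mul_diagonal,
      Matrix.diagonal_mul, hS.symm.apply i j]
    ring
  diag i := by
    simp [SeidelMatrix.switch, signMatrix, hS.diag i]
  offDiag i j hij := by
    simp only [SeidelMatrix.switch, signMatrix, Matrix.mul_diagonal, Matrix.diagonal_mul]
    rcases hS.offDiag i j hij with h | h <;> rw [h] <;> split_ifs <;> norm_num

/-- The switching class `[S]`: all graphs obtained from the graph of `S` by switching. -/
def switchingClass [Fintype V] (S : Matrix V V ℝ) (hS : IsSeidel S) : Set (SimpleGraph V) :=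
  {G | ∃ U : Set V, G = graph (switch S U) (hS.switch U)}

/-- The block matrix with diagonal blocks `S` and off-diagonal blocks `-S + I`. -/
def double (S : Matrix V V ℝ) : Matrix (V ⊕ V) (V ⊕ V) ℝ :=
  Matrix.fromBlocks S (-S + 1) (-S + 1) S

theorem IsSeidel.double {S : Matrix V V ℝ} (hS : IsSeidel S) : IsSeidel (double S) where
  symm := by
    simp [SeidelMatrix.double, Matrix.IsSymm, Matrix.fromBlocks_transpose, hS.symm.eq]
  diag i := by
    rcases i with i | i <;> simp [SeidelMatrix.double, hS.diag i]
  offDiag := by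
    have key : ∀ i j, (-S + 1) i j = 1 ∨ (-S + 1) i j = -1 := by
      intro i j
      by_cases hij : i = j
      · subst hij
        simp [hS.diag i]
      · rcases hS.offDiag i j hij with h | h <;> simp [h, hij]
    rintro (i | i) (j | j) hij
    · exact hS.offDiag i j fun h => hij (by rw [h])
    · exact key i j
    · exact key i j
    · exact hS.offDiag i j fun h => hij (by rw [h])

/-- The switching graph of `S`: the graph of the Seidel matrix `double S`. -/
def switchingGraph (S : Matrix V V ℝ) (hS : IsSeidel S) : SimpleGraph (V ⊕ V) :=
  graph (double S) hS.double

/-- The independence number `α([S])` of the switching class of `S`, which is by definition the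
independence number of the switching graph of `S`. -/
noncomputable def classIndepNum (S : Matrix V V ℝ) (hS : IsSeidel S) : ℕ :=
  (switchingGraph S hS).indepNum

end SeidelMatrix

open Matrix Finset

/-! ### Linear algebra of `J + 2 M` for symmetric `M` with nonpositive off-diagonal entries. -/

section LinearAlgebra

set_option linter.unusedSectionVars false

variable {V : Type*} [Fintype V] [DecidableEq V]

/-! If `A` is the adjacency matrix of the graph `G` of a Seidel matrix, then `S + 5 I = J + 2 M`
with `M = 2 I - A`. Switching preserves rank and positive semidefiniteness, so one may choose the
graph: make an independent 49-set `I` in which every outside vertex has at most 24 neighbours.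

Degree bound. Eliminating the coordinates in `I` from the form `J + 2 M`
(`schur_complement_indepSet`) and testing on explicit vectors shows that outside vertices have at
most 4 neighbours in `I`, and then that all degrees are at most 6.

Rank bound. If `M ≥ 0`, the trace of `(I + A)²` bounds the multiplicity of the eigenvalue 2 of `A`
by `n / 3`, and Perron–Frobenius gains the extra 1 (`rank_onesAdd_of_nonneg`). Otherwise `M` has a
negative vector. If a small subgraph has spectral radius at least 2, it can be enlarged by a vertex
to carry a negative vector. As `J` has rank one, a second vector on which `M` is not positive cannot
live away from it, so the rank is at least `n - 49`. If there is no such subgraph, small extended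
Dynkin diagrams are excluded and `G` is so sparse that the trace of `(A² + 2 A)²` bounds the
multiplicity of 2 by `3 n / 10`. -/

theorem Matrix.IsHermitian.trace_mul_self_eq_sum {X : Matrix V V ℝ} (hX : X.IsHermitian) :
    (X * X).trace = ∑ i, hX.eigenvalues i ^ 2 := by
  have h := hX.spectral_theorem
  have h2 : X * X = Unitary.conjStarAlgAut ℝ _ hX.eigenvectorUnitary
      (diagonal (fun i => hX.eigenvalues i ^ 2)) := by
    conv_lhs => rw [h]
    rw [← map_mul, diagonal_mul_diagonal]
    congr 2
    ext i
    simp [sq]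
  rw [h2, Unitary.conjStarAlgAut_apply, trace_mul_comm, ← mul_assoc]
  simp [trace_diagonal]

/-- Each null vector of `X` is an eigenvector of `(c - X)²` for `c²`, and the other eigenvalues of
that square are nonnegative. -/
theorem Matrix.IsHermitian.sq_mul_nullity_le_trace {X : Matrix V V ℝ} (hX : X.IsHermitian)
    (c : ℝ) :
    c ^ 2 * (Fintype.card V - X.rank) ≤ ((c • 1 - X) * (c • 1 - X)).trace := by
  have h1 : ((c • 1 - X) * (c • 1 - X)).trace = ∑ i, (c - hX.eigenvalues i) ^ 2 := by
    have : (c • (1 : Matrix V V ℝ) - X) * (c • 1 - X)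
        = (c ^ 2) • 1 - (2 * c) • X + X * X := by
      simp only [sub_mul, mul_sub, smul_mul_assoc, one_mul, mul_smul_comm, mul_one]
      module
    rw [this, trace_add, trace_sub, trace_smul, trace_smul, trace_one,
      hX.trace_mul_self_eq_sum, hX.trace_eq_sum_eigenvalues]
    simp only [sub_sq, sum_add_distrib, sum_sub_distrib, sum_const, card_univ, ← mul_sum,
      smul_eq_mul, nsmul_eq_mul, RCLike.ofReal_real_eq_id, id]
    ring
  have h2 : (Fintype.card V : ℝ) - X.rank = ∑ i, if hX.eigenvalues i = 0 then (1 : ℝ) else 0 := by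
    rw [hX.rank_eq_card_non_zero_eigs, Fintype.card_subtype, sum_boole,
      ← card_univ, ← card_filter_add_card_filter_not (fun i => hX.eigenvalues i = 0)]
    push_cast
    ring
  rw [h1, h2, mul_sum]
  refine sum_le_sum fun i _ => ?_
  split_ifs with h
  · simp [h]
  · simp [sq_nonneg]

/-- The Perron–Frobenius step: taking absolute values fixes the diagonal terms and can only lower
the off-diagonal ones. -/
theorem Matrix.quadForm_abs_le {M : Matrix V V ℝ} (hM : ∀ i j, i ≠ j → M i j ≤ 0) (z : V → ℝ) :
    |z| ⬝ᵥ M *ᵥ |z| ≤ z ⬝ᵥ M *ᵥ z := by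
  simp only [dotProduct, mulVec, mul_sum, Pi.abs_apply]
  refine sum_le_sum fun i _ => sum_le_sum fun j _ => ?_
  rcases eq_or_ne i j with rfl | h
  · rw [mul_left_comm, abs_mul_abs_self, mul_left_comm]
  · have := le_abs_self (z i * z j)
    rw [abs_mul] at this
    nlinarith [hM i j h]

theorem Matrix.quadForm_add_smul {M : Matrix V V ℝ} (hM : M.IsSymm) (y z : V → ℝ) (c : ℝ) :
    (y + c • z) ⬝ᵥ M *ᵥ (y + c • z)
      = y ⬝ᵥ M *ᵥ y + 2 * c * (z ⬝ᵥ M *ᵥ y) + c ^ 2 * (z ⬝ᵥ M *ᵥ z) := by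
  have h : y ⬝ᵥ M *ᵥ z = z ⬝ᵥ M *ᵥ y := by
    rw [dotProduct_mulVec, ← mulVec_transpose, hM.eq, dotProduct_comm]
  simp only [mulVec_add, mulVec_smul, add_dotProduct, dotProduct_add, smul_dotProduct,
    dotProduct_smul, smul_eq_mul, h]
  ring

theorem Matrix.card_le_rank_of_principal {K : Matrix V V ℝ} (T : Finset V)
    (h : ∀ w : V → ℝ, (∀ i ∉ T, w i = 0) → K *ᵥ w = 0 → w = 0) : #T ≤ K.rank := by
  let E : (T → ℝ) →ₗ[ℝ] (V → ℝ) := Function.ExtendByZero.linearMap ℝ ((↑) : T → V)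
  have hE : ∀ (w : T → ℝ) (i : T), E w i = w i := fun w i =>
    Subtype.val_injective.extend_apply w 0 i
  have hE0 : ∀ (w : T → ℝ) (i : V), i ∉ T → E w i = 0 := fun w i hi =>
    Function.extend_apply' _ _ _ (by rintro ⟨a, rfl⟩; exact hi a.2)
  have hinj : Function.Injective (K.mulVecLin ∘ₗ E) := by
    rw [← LinearMap.ker_eq_bot, LinearMap.ker_eq_bot']
    intro w hw
    have := h (E w) (hE0 w) (by simpa using hw)
    ext i
    rw [← hE w i, this]; rfl
  have h1 := LinearMap.finrank_range_of_inj hinj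
  rw [Module.finrank_fintype_fun_eq_card, Fintype.card_coe] at h1
  rw [← h1]
  exact Submodule.finrank_mono (LinearMap.range_comp_le_range _ _)

/-- The matrix `J + 2 M`, with `J` the all-ones matrix. -/
def onesAdd (M : Matrix V V ℝ) : Matrix V V ℝ := Matrix.of (fun _ _ => 1) + (2 : ℝ) • M

theorem onesAdd_quadForm (M : Matrix V V ℝ) (z : V → ℝ) :
    z ⬝ᵥ onesAdd M *ᵥ z = (∑ i, z i) ^ 2 + 2 * (z ⬝ᵥ M *ᵥ z) := by
  have : (Matrix.of (fun _ _ => 1) : Matrix V V ℝ) *ᵥ z = fun _ => ∑ i, z i := by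
    ext i; simp [mulVec, dotProduct]
  rw [onesAdd, add_mulVec, dotProduct_add, this, smul_mulVec, dotProduct_smul, smul_eq_mul,
    sq, dotProduct, ← sum_mul]

theorem Matrix.rank_add_le_rank_add_rank (A B : Matrix V V ℝ) :
    (A + B).rank ≤ A.rank + B.rank := by
  refine (Submodule.finrank_mono ?_).trans
    (Submodule.finrank_add_le_finrank_add_finrank _ _)
  rintro _ ⟨x, rfl⟩
  rw [mulVecLin_apply, add_mulVec]
  exact Submodule.add_mem_sup (LinearMap.mem_range_self A.mulVecLin x)
    (LinearMap.mem_range_self B.mulVecLin x)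

theorem rank_le_rank_onesAdd_add_one (M : Matrix V V ℝ) : M.rank ≤ (onesAdd M).rank + 1 := by
  have h : M = (2 : ℝ)⁻¹ • onesAdd M + vecMulVec (fun _ => -(2 : ℝ)⁻¹) (fun _ => 1) := by
    ext i j
    simp [onesAdd, vecMulVec_apply]
  have h1 : ((2 : ℝ)⁻¹ • onesAdd M).rank ≤ (onesAdd M).rank := by
    have : (2 : ℝ)⁻¹ • onesAdd M = onesAdd M * ((2 : ℝ)⁻¹ • 1) := by simp
    rw [this]
    exact rank_mul_le_left _ _
  have h2 := rank_vecMulVec_le (fun _ : V => -(2 : ℝ)⁻¹) (fun _ : V => (1 : ℝ))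
  have h3 := Matrix.rank_add_le_rank_add_rank ((2 : ℝ)⁻¹ • onesAdd M)
    (vecMulVec (fun _ : V => -(2 : ℝ)⁻¹) (fun _ : V => (1 : ℝ)))
  rw [← h] at h3
  omega

variable {M : Matrix V V ℝ}

/-- Otherwise a multiple of `w` added to `y` cancels the coordinate sum without changing the form
`M`, leaving a negative value in `hpos`. -/
theorem sum_eq_zero_of_mulVec_eq_zero (hM : M.IsSymm)
    (hpos : ∀ z : V → ℝ, 0 ≤ (∑ i, z i) ^ 2 + 2 * (z ⬝ᵥ M *ᵥ z))
    {y : V → ℝ} (hy : y ⬝ᵥ M *ᵥ y < 0) {w : V → ℝ} (hw : M *ᵥ w = 0) : ∑ i, w i = 0 := by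
  by_contra h
  have h1 := hpos (y + (-(∑ i, y i) / ∑ i, w i) • w)
  have h2 : w ⬝ᵥ M *ᵥ y = 0 := by
    rw [dotProduct_mulVec, ← mulVec_transpose, hM.eq, hw, zero_dotProduct]
  rw [quadForm_add_smul hM, hw, h2] at h1
  simp only [Pi.add_apply, Pi.smul_apply, smul_eq_mul, sum_add_distrib, ← mul_sum,
    dotProduct_zero] at h1
  rw [div_mul_cancel₀ _ h] at h1
  nlinarith

theorem sum_abs_pos {w : V → ℝ} (hw : w ≠ 0) : 0 < ∑ i, |w| i := by
  obtain ⟨i, hi⟩ := Function.ne_iff.1 hw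
  exact sum_pos' (fun i _ => abs_nonneg (w i)) ⟨i, mem_univ _, abs_pos.2 hi⟩

/-- Two vectors with disjoint, mutually non-interacting supports cannot both fail to be positive
for `M` when `J + 2 M` is positive semidefinite. -/
theorem quadForm_pos_of_separated (hM : M.IsSymm) (hoff : ∀ i j, i ≠ j → M i j ≤ 0)
    (hpos : ∀ z : V → ℝ, 0 ≤ (∑ i, z i) ^ 2 + 2 * (z ⬝ᵥ M *ᵥ z))
    {f w : V → ℝ} (hf : f ⬝ᵥ M *ᵥ f < 0) (hw : w ≠ 0)
    (hsep : ∀ i j, f i ≠ 0 → w j ≠ 0 → M i j = 0) : 0 < w ⬝ᵥ M *ᵥ w := by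
  by_contra hneg
  have hf' := (quadForm_abs_le hoff f).trans_lt hf
  have hw' := (quadForm_abs_le hoff w).trans (not_lt.1 hneg)
  have hsum := sum_abs_pos hw
  -- The coefficient makes the coordinate sum vanish, so the `J` term disappears; separation removes
  -- the cross term, leaving a negative value.
  have h1 := hpos (|f| + (-(∑ i, |f| i) / ∑ i, |w| i) • |w|)
  have h2 : |w| ⬝ᵥ M *ᵥ |f| = 0 := by
    simp only [dotProduct, mulVec, mul_sum]
    refine sum_eq_zero fun j _ => sum_eq_zero fun i _ => ?_
    by_cases hi : f i = 0
    · simp [hi]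
    by_cases hj : w j = 0
    · simp [hj]
    rw [← hM.apply, hsep i j hi hj]; ring
  rw [quadForm_add_smul hM, h2] at h1
  simp only [Pi.add_apply, Pi.smul_apply, smul_eq_mul, sum_add_distrib, ← mul_sum] at h1
  rw [div_mul_cancel₀ _ hsum.ne'] at h1
  nlinarith [sq_nonneg (-(∑ i, |f| i) / ∑ i, |w| i)]

/-- No kernel vector of `J + 2 M` lives off `N`: it would be separated from `f`, hence positive for
`M`. -/
theorem rank_onesAdd_ge_of_quadForm_neg (hM : M.IsSymm) (hoff : ∀ i j, i ≠ j → M i j ≤ 0)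
    (hpos : ∀ z : V → ℝ, 0 ≤ (∑ i, z i) ^ 2 + 2 * (z ⬝ᵥ M *ᵥ z))
    {f : V → ℝ} (hf : f ⬝ᵥ M *ᵥ f < 0) (N : Finset V)
    (hN : ∀ i j, f i ≠ 0 → j ∉ N → M i j = 0) :
    (Fintype.card V : ℝ) - #N ≤ (onesAdd M).rank := by
  have h := card_le_rank_of_principal (K := onesAdd M) Nᶜ fun w hw0 hw => by
    by_contra hne
    have h1 := quadForm_pos_of_separated hM hoff hpos hf hne fun i j hi hj =>
      hN i j hi fun hjN => hj (hw0 j (by simpa using hjN))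
    have h2 := onesAdd_quadForm M w
    rw [hw, dotProduct_zero] at h2
    nlinarith [sq_nonneg (∑ i, w i)]
  rw [card_compl] at h
  have h3 : (Fintype.card V : ℝ) ≤ (onesAdd M).rank + #N := by
    exact_mod_cast (by omega : Fintype.card V ≤ (onesAdd M).rank + #N)
  linarith

/-- A nonnegative vector on which `M` is not positive can be perturbed at one further coordinate
to a vector on which `M` is negative. -/
theorem exists_quadForm_neg_update (hM : M.IsSymm) (hdiag : ∀ i, M i i = 2)
    (hpos : ∀ z : V → ℝ, 0 ≤ (∑ i, z i) ^ 2 + 2 * (z ⬝ᵥ M *ᵥ z))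
    {y : V → ℝ} (hy : y ⬝ᵥ M *ᵥ y < 0)
    {f : V → ℝ} (hf : f ⬝ᵥ M *ᵥ f ≤ 0) (hf1 : ∑ i, f i ≠ 0) :
    ∃ (v : V) (g : V → ℝ), g ⬝ᵥ M *ᵥ g < 0 ∧ ∀ i, g i ≠ 0 → f i ≠ 0 ∨ i = v := by
  have hne : M *ᵥ f ≠ 0 := fun h => hf1 (sum_eq_zero_of_mulVec_eq_zero hM hpos hy h)
  obtain ⟨v, hv⟩ := Function.ne_iff.1 hne
  simp only [Pi.zero_apply] at hv
  -- As `M v v = 2`, this coefficient minimises the form along coordinate `v`, lowering it by `(M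
  -- f)_v² / 2`.
  refine ⟨v, f + (-((M *ᵥ f) v) / 2) • Pi.single v 1, ?_, fun i hi => ?_⟩
  · rw [quadForm_add_smul hM, single_one_dotProduct, single_one_dotProduct, mulVec_single_one,
      col_apply, hdiag]
    have := sq_pos_of_ne_zero hv
    nlinarith
  · by_contra! h
    simp [h.1, h.2] at hi

/-- The kernel of `J + 2 M` is the part of `ker M` with coordinate sum zero. If `ker M` contains `z
≠ 0` it also contains `|z|`, whose sum is positive, so the inclusion of kernels is strict. -/
theorem rank_onesAdd_of_nonneg (hM : M.IsSymm) (hoff : ∀ i j, i ≠ j → M i j ≤ 0)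
    (hq : ∀ z : V → ℝ, 0 ≤ z ⬝ᵥ M *ᵥ z) :
    (onesAdd M).rank = Fintype.card V ∨ M.rank + 1 ≤ (onesAdd M).rank := by
  have hpsd : M.PosSemidef := PosSemidef.of_dotProduct_mulVec_nonneg hM fun z => hq z
  have hker : ∀ z, onesAdd M *ᵥ z = 0 → ∑ i, z i = 0 ∧ M *ᵥ z = 0 := by
    intro z hz
    have h1 := onesAdd_quadForm M z
    rw [hz, dotProduct_zero] at h1
    have h2 := hq z
    have h3 := sq_nonneg (∑ i, z i)
    refine ⟨pow_eq_zero_iff two_ne_zero |>.1 (by linarith), ?_⟩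
    exact (hpsd.dotProduct_mulVec_zero_iff z).1 (show z ⬝ᵥ M *ᵥ z = 0 by linarith)
  have hle : LinearMap.ker (onesAdd M).mulVecLin ≤ LinearMap.ker M.mulVecLin := fun z hz => by
    simp only [LinearMap.mem_ker, mulVecLin_apply] at hz ⊢
    exact (hker z hz).2
  have r1 := LinearMap.finrank_range_add_finrank_ker M.mulVecLin
  have r2 := LinearMap.finrank_range_add_finrank_ker (onesAdd M).mulVecLin
  rw [Module.finrank_fintype_fun_eq_card] at r1 r2
  by_cases h : ∃ z, z ≠ 0 ∧ M *ᵥ z = 0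
  · right
    obtain ⟨z, hz0, hz⟩ := h
    have hz' : M *ᵥ |z| = 0 := by
      refine (hpsd.dotProduct_mulVec_zero_iff |z|).1 (le_antisymm ?_ (hq |z|))
      refine (quadForm_abs_le hoff z).trans ?_
      rw [hz, dotProduct_zero]
    have hlt : LinearMap.ker (onesAdd M).mulVecLin < LinearMap.ker M.mulVecLin := by
      refine lt_of_le_of_ne hle fun heq => ?_
      have : |z| ∈ LinearMap.ker (onesAdd M).mulVecLin := by
        rw [heq]; simpa using hz'
      have := (hker |z| (by simpa using this)).1
      exact (sum_abs_pos hz0).ne' this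
    have := Submodule.finrank_lt_finrank_of_lt hlt
    simp only [Matrix.rank]
    omega
  · left
    push Not at h
    have : LinearMap.ker (onesAdd M).mulVecLin = ⊥ := by
      rw [LinearMap.ker_eq_bot']
      intro z hz
      by_contra hne
      exact h z hne (hker z (by simpa using hz)).2
    rw [this, finrank_bot] at r2
    simp only [Matrix.rank]
    omega

end LinearAlgebra

/-! ### Rank bounds for graphs of small degree. -/

namespace SimpleGraph

section GraphRank

set_option linter.unusedSectionVars false

variable {V : Type*} [Fintype V] [DecidableEq V] (G : SimpleGraph V) [DecidableRel G.Adj]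

/-- The matrix `2 I - A`, with `A` the adjacency matrix of `G`. -/
def twoSubAdj : Matrix V V ℝ := (2 : ℝ) • 1 - G.adjMatrix ℝ

theorem twoSubAdj_isSymm : G.twoSubAdj.IsSymm :=
  (isSymm_one.smul 2).sub G.isSymm_adjMatrix

theorem twoSubAdj_self (i : V) : G.twoSubAdj i i = 2 := by
  simp [twoSubAdj]

theorem twoSubAdj_of_ne {i j : V} (h : i ≠ j) :
    G.twoSubAdj i j = -(if G.Adj i j then 1 else 0) := by
  simp [twoSubAdj, h, adjMatrix_apply]

theorem twoSubAdj_of_adj {i j : V} (h : G.Adj i j) : G.twoSubAdj i j = -1 := by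
  simp [twoSubAdj_of_ne G h.ne, h]

theorem twoSubAdj_nonpos (i j : V) (h : i ≠ j) : G.twoSubAdj i j ≤ 0 := by
  rw [twoSubAdj_of_ne G h]
  split_ifs <;> simp

theorem quadForm_combination {M : Matrix V V ℝ} {m : ℕ} (g : Fin m → V) (c : Fin m → ℝ) :
    (∑ k, c k • Pi.single (g k) (1 : ℝ)) ⬝ᵥ M *ᵥ (∑ k, c k • Pi.single (g k) (1 : ℝ))
      = ∑ k, ∑ l, c k * c l * M (g k) (g l) := by
  rw [mulVec_sum, sum_dotProduct]
  refine sum_congr rfl fun k _ => ?_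
  rw [dotProduct_sum]
  refine sum_congr rfl fun l _ => ?_
  rw [mulVec_smul, smul_dotProduct, dotProduct_smul, single_one_dotProduct, mulVec_single_one,
    col_apply]
  simp [mul_assoc]

variable {G}

/-- A small subgraph of spectral radius at least two forces large rank. -/
theorem rank_ge_of_small_subgraph {d : ℕ} (hΔ : ∀ v, G.degree v ≤ d)
    (hpos : ∀ z : V → ℝ, 0 ≤ (∑ i, z i) ^ 2 + 2 * (z ⬝ᵥ G.twoSubAdj *ᵥ z))
    {y : V → ℝ} (hy : y ⬝ᵥ G.twoSubAdj *ᵥ y < 0)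
    {m : ℕ} (g : Fin m → V) (c : Fin m → ℝ) (hc : ∑ k, c k ≠ 0)
    (hq : ∑ k, ∑ l, c k * c l * G.twoSubAdj (g k) (g l) ≤ 0) :
    (Fintype.card V : ℝ) - (m + 1) * (d + 1) ≤ (onesAdd G.twoSubAdj).rank := by
  obtain ⟨v, f, hf, hfs⟩ := exists_quadForm_neg_update G.twoSubAdj_isSymm G.twoSubAdj_self hpos hy
    (f := ∑ k, c k • Pi.single (g k) 1) (by rwa [quadForm_combination]) (by
      simpa [Finset.sum_apply, sum_comm (s := (univ : Finset V)), Pi.single_apply] using hc)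
  let F : Finset V := insert v (univ.image g)
  have hF : ∀ i, f i ≠ 0 → i ∈ F := fun i hi => by
    rcases hfs i hi with h | rfl
    · rw [Finset.sum_apply] at h
      obtain ⟨k, _, hk⟩ := exists_ne_zero_of_sum_ne_zero h
      refine mem_insert_of_mem (mem_image.2 ⟨k, mem_univ _, ?_⟩)
      by_contra hne
      simp [Ne.symm hne] at hk
    · exact mem_insert_self _ _
  have hFc : #F ≤ m + 1 := by
    refine (card_insert_le _ _).trans ?_
    have := card_image_le (s := (univ : Finset (Fin m))) (f := g)
    simp only [card_univ, Fintype.card_fin] at this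
    omega
  -- The closed neighbourhood of the support of `f`: outside it, `M` has no interaction with `f`.
  let N : Finset V := F.biUnion fun i => insert i (G.neighborFinset i)
  have hNc : #N ≤ (m + 1) * (d + 1) := by
    refine (card_biUnion_le_card_mul F _ (d + 1) fun i _ => ?_).trans
      (Nat.mul_le_mul_right _ hFc)
    refine (card_insert_le _ _).trans ?_
    rw [card_neighborFinset_eq_degree]
    exact Nat.succ_le_succ (hΔ i)
  have h := rank_onesAdd_ge_of_quadForm_neg G.twoSubAdj_isSymm G.twoSubAdj_nonpos hpos hf N
    fun i j hi hj => by
      have hj' : j ∉ insert i (G.neighborFinset i) := fun h => hj (mem_biUnion.2 ⟨i, hF i hi, h⟩)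
      simp only [mem_insert, mem_neighborFinset, not_or] at hj'
      rw [twoSubAdj_of_ne G (Ne.symm hj'.1)]
      simp [hj'.2]
  have : (#N : ℝ) ≤ (m + 1) * (d + 1) := by exact_mod_cast hNc
  linarith

theorem trace_mul_self_of_isSymm {P : Matrix V V ℝ} (hP : P.IsSymm) :
    (P * P).trace = ∑ i, ∑ j, P i j ^ 2 := by
  simp only [trace, diag_apply, mul_apply]
  refine sum_congr rfl fun i _ => sum_congr rfl fun j _ => ?_
  rw [hP.apply i j, sq]

theorem sum_adjMatrix_row (i : V) : ∑ j, G.adjMatrix ℝ i j = G.degree i := by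
  simp [adjMatrix_apply, ← card_neighborFinset_eq_degree, neighborFinset_eq_filter]

/-- If the adjacency matrix has no eigenvalue above two, then two has multiplicity at most a
third of the order. -/
theorem rank_onesAdd_of_quadForm_nonneg
    (hq : ∀ z : V → ℝ, 0 ≤ z ⬝ᵥ G.twoSubAdj *ᵥ z) (hn : 3 ≤ Fintype.card V) :
    2 * (Fintype.card V : ℝ) / 3 + 1 ≤ (onesAdd G.twoSubAdj).rank := by
  -- The all-ones vector gives average degree at most 2, so the trace of `(I + A)²` is at most `3
  -- n`, while each null vector of `M` contributes 9.
  have h1 := hq (fun _ => 1)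
  have h2 := (show G.twoSubAdj.IsHermitian from G.twoSubAdj_isSymm).sq_mul_nullity_le_trace 3
  have h3 : (3 : ℝ) • (1 : Matrix V V ℝ) - G.twoSubAdj = 1 + G.adjMatrix ℝ := by
    rw [twoSubAdj]; module
  rw [h3, trace_mul_self_of_isSymm (isSymm_one.add G.isSymm_adjMatrix)] at h2
  have h4 : ∀ i j, (1 + G.adjMatrix ℝ) i j ^ 2 = (1 : Matrix V V ℝ) i j + G.adjMatrix ℝ i j := by
    intro i j
    by_cases hij : i = j
    · simp [hij, one_apply]
    · by_cases ha : G.Adj i j <;> simp [one_apply, hij, adjMatrix_apply, ha]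
  have h5 : ∀ i : V, ∑ j, (1 : Matrix V V ℝ) i j = 1 := fun i => by simp [one_apply]
  simp only [h4, sum_add_distrib, sum_adjMatrix_row, h5] at h2
  have h6 : (fun _ => 1 : V → ℝ) ⬝ᵥ G.twoSubAdj *ᵥ (fun _ => 1)
      = 2 * Fintype.card V - ∑ i, (G.degree i : ℝ) := by
    simp only [dotProduct, mulVec, twoSubAdj, Matrix.sub_apply, Matrix.smul_apply, mul_one,
      one_mul, sum_sub_distrib, sum_adjMatrix_row, smul_eq_mul, ← mul_sum, h5]
    simp [mul_comm]
  rw [h6] at h1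
  simp only [sum_const, card_univ, nsmul_eq_mul, mul_one] at h2
  rcases rank_onesAdd_of_nonneg G.twoSubAdj_isSymm G.twoSubAdj_nonpos hq with h | h
  · rw [h]
    have : (3 : ℝ) ≤ Fintype.card V := by exact_mod_cast hn
    linarith
  · have : (G.twoSubAdj.rank : ℝ) + 1 ≤ (onesAdd G.twoSubAdj).rank := by exact_mod_cast h
    linarith

/-- In a graph of girth at least five and maximum degree three with no two adjacent vertices of
degree three, two is an eigenvalue of multiplicity at most `0.3` times the order. -/
theorem rank_twoSubAdj_ge_of_sparse
    (h3 : ∀ a b c, G.Adj a b → G.Adj b c → ¬ G.Adj a c)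
    (h4 : ∀ a b c d, a ≠ c → b ≠ d → G.Adj a b → G.Adj b c → G.Adj c d → ¬ G.Adj d a)
    (hd : ∀ v, G.degree v ≤ 3)
    (hdd : ∀ u v, G.Adj u v → G.degree u = 3 → G.degree v ≠ 3) :
    (7 / 10 : ℝ) * Fintype.card V ≤ G.twoSubAdj.rank := by
  set A := G.adjMatrix ℝ with hA
  have hAs : A.IsSymm := G.isSymm_adjMatrix
  -- The polynomial `t² + 2 t` takes the value 8 at `t = 2`, so null vectors of `M` contribute 64
  -- each to the trace of `(A² + 2 A)²`.
  have hX : (8 : ℝ) • (1 : Matrix V V ℝ) - G.twoSubAdj * ((4 : ℝ) • 1 + A)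
      = A * A + (2 : ℝ) • A := by
    rw [twoSubAdj, ← hA]
    simp only [sub_mul, mul_add, smul_mul_assoc, one_mul, mul_smul_comm, mul_one]
    module
  have hPs : (A * A + (2 : ℝ) • A).IsSymm := by
    refine IsSymm.add ?_ (hAs.smul 2)
    rw [IsSymm, transpose_mul, hAs.eq]
  have hXh : (G.twoSubAdj * ((4 : ℝ) • 1 + A)).IsHermitian := by
    have : G.twoSubAdj * ((4 : ℝ) • 1 + A) = (8 : ℝ) • 1 - (A * A + (2 : ℝ) • A) := by
      rw [← hX]; abel
    rw [this]
    exact (isSymm_one.smul (8 : ℝ)).sub hPs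
  have key := hXh.sq_mul_nullity_le_trace 8
  rw [hX, trace_mul_self_of_isSymm hPs] at key
  have hrank : ((G.twoSubAdj * ((4 : ℝ) • 1 + A)).rank : ℝ) ≤ G.twoSubAdj.rank := by
    exact_mod_cast rank_mul_le_left _ _
  have hcommon : ∀ i j, (A * A) i j = #(G.neighborFinset i ∩ G.neighborFinset j) := by
    intro i j
    simp only [hA, adjMatrix_mul_apply, adjMatrix_apply, sum_boole]
    congr 2
    ext k
    simp [G.adj_comm k j]
  have hAapp : ∀ i j, A i j = if G.Adj i j then 1 else 0 := fun i j => by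
    rw [hA, adjMatrix_apply]
  have hrow : ∀ i, ∑ j, A i j = G.degree i := sum_adjMatrix_row
  clear_value A
  have hself : ∀ i, (A * A) i i = G.degree i := fun i => by
    rw [hcommon, inter_self, card_neighborFinset_eq_degree]
  -- Without triangles or 4-cycles, an off-diagonal entry is 2 for an edge, and otherwise the number
  -- 0 or 1 of common neighbours.
  have hentry : ∀ i j, (A * A + (2 : ℝ) • A) i j ^ 2
      ≤ (A * A) i j + 4 * A i j + if i = j then (G.degree i : ℝ) ^ 2 - G.degree i else 0 := by
    intro i j
    by_cases hij : i = j
    · subst hij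
      simp [hself, hAapp]
    · have hle : #(G.neighborFinset i ∩ G.neighborFinset j) ≤ 1 := by
        rw [card_le_one]
        intro a ha b hb
        simp only [mem_inter, mem_neighborFinset] at ha hb
        by_contra hab
        exact h4 i a j b hij hab ha.1 ha.2.symm hb.2 hb.1.symm
      simp only [Matrix.add_apply, Matrix.smul_apply, smul_eq_mul, hij, if_false, hcommon, hAapp]
      split_ifs with hadj
      · have : #(G.neighborFinset i ∩ G.neighborFinset j) = 0 := by
          rw [card_eq_zero, eq_empty_iff_forall_notMem]
          intro a ha
          simp only [mem_inter, mem_neighborFinset] at ha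
          exact h3 i a j ha.1 ha.2.symm hadj
        rw [this]; norm_num
      · interval_cases #(G.neighborFinset i ∩ G.neighborFinset j) <;> norm_num
  have hAcol : ∀ k, ∑ i, A i k = G.degree k := fun k => by
    rw [← hrow k]
    exact sum_congr rfl fun i _ => hAs.apply k i
  have hAA : ∑ i, ∑ j, (A * A) i j = ∑ k, (G.degree k : ℝ) ^ 2 := by
    simp only [mul_apply]
    have : ∀ i, ∑ j, ∑ k, A i k * A k j = ∑ k, A i k * G.degree k := fun i => by
      rw [sum_comm]
      refine sum_congr rfl fun k _ => ?_
      rw [← mul_sum, hrow]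
    simp only [this]
    rw [sum_comm]
    refine sum_congr rfl fun k _ => ?_
    rw [← sum_mul, hAcol, sq]
  have htot : ∑ i, ∑ j, (A * A + (2 : ℝ) • A) i j ^ 2
      ≤ ∑ i, (2 * (G.degree i : ℝ) ^ 2 + 3 * G.degree i) := by
    refine (sum_le_sum fun i _ => sum_le_sum fun j _ => hentry i j).trans (le_of_eq ?_)
    simp only [sum_add_distrib, hAA, ← mul_sum, hrow, sum_ite_eq, mem_univ,
      if_true, sum_sub_distrib]
    ring
  let t : V → ℝ := fun i => if G.degree i = 3 then 1 else 0
  -- Discharging along edges: no edge joins two vertices of degree 3.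
  have hdis : ∑ k, (G.degree k : ℝ) * t k ≤ ∑ i, (G.degree i : ℝ) * (1 - t i) := by
    have e1 : ∑ k, (G.degree k : ℝ) * t k = ∑ i, ∑ k, A i k * t k := by
      rw [sum_comm]
      exact sum_congr rfl fun k _ => by rw [← sum_mul, hAcol]
    have e2 : ∑ i, (G.degree i : ℝ) * (1 - t i) = ∑ i, ∑ k, A i k * (1 - t i) :=
      sum_congr rfl fun i _ => by rw [← sum_mul, hrow]
    rw [e1, e2]
    refine sum_le_sum fun i _ => sum_le_sum fun k _ => ?_
    by_cases hik : G.Adj i k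
    · have := hdd i k hik
      by_cases hi : G.degree i = 3
      · simp [t, hi, this hi]
      · simp only [t, hi, hAapp, hik, if_true, if_false]
        split_ifs <;> norm_num
    · simp [hAapp, hik]
  -- The constants give equality at degrees 2 and 3. The bracket sums to at most 0 by `hdis`, and
  -- `(96 / 5) / 64 = 3 / 10`.
  have hvert : ∀ i, 2 * (G.degree i : ℝ) ^ 2 + 3 * G.degree i
      ≤ 96 / 5 + 13 / 5 * (G.degree i * t i - G.degree i * (1 - t i)) := by
    intro i
    have := hd i
    simp only [t]
    interval_cases G.degree i <;> norm_num
  have hsum := sum_le_sum fun i (_ : i ∈ (univ : Finset V)) => hvert i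
  rw [sum_add_distrib (f := fun _ => (96 / 5 : ℝ)), ← mul_sum, sum_sub_distrib] at hsum
  simp only [sum_const, card_univ, nsmul_eq_mul] at hsum
  linarith

/-- The rank bound for graphs of bounded degree. -/
theorem rank_onesAdd_ge_of_degree_le (hn : 150 ≤ Fintype.card V) (hΔ : ∀ v, G.degree v ≤ 6)
    (hpos : ∀ z : V → ℝ, 0 ≤ (∑ i, z i) ^ 2 + 2 * (z ⬝ᵥ G.twoSubAdj *ᵥ z)) :
    2 * (Fintype.card V : ℝ) / 3 + 1 ≤ (onesAdd G.twoSubAdj).rank := by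
  by_cases hq : ∀ z : V → ℝ, 0 ≤ z ⬝ᵥ G.twoSubAdj *ᵥ z
  · exact rank_onesAdd_of_quadForm_nonneg hq (by omega)
  push Not at hq
  obtain ⟨y, hy⟩ := hq
  by_contra hcon
  have hn' : (150 : ℝ) ≤ Fintype.card V := by exact_mod_cast hn
  -- At most 7 vertices with degrees at most 6 have at most 49 vertices in their closed
  -- neighbourhoods, and `n - 49 ≥ 2 n / 3 + 1` exactly when `n ≥ 150`.
  have small : ∀ {m : ℕ} (g : Fin m → V) (c : Fin m → ℝ), m ≤ 6 → ∑ k, c k ≠ 0 →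
      ¬ ∑ k, ∑ l, c k * c l * G.twoSubAdj (g k) (g l) ≤ 0 := by
    intro m g c hm hc hq
    have h := rank_ge_of_small_subgraph hΔ hpos hy g c hc hq
    have hm' : (m : ℝ) ≤ 6 := by exact_mod_cast hm
    push_cast at h
    apply hcon
    linarith
  have self := G.twoSubAdj_self
  have adj : ∀ {i j}, G.Adj i j → G.twoSubAdj i j = -1 ∧ G.twoSubAdj j i = -1 := fun h =>
    ⟨G.twoSubAdj_of_adj h, G.twoSubAdj_of_adj h.symm⟩
  have nonpos : ∀ {i j}, i ≠ j → G.twoSubAdj i j ≤ 0 ∧ G.twoSubAdj j i ≤ 0 := fun h =>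
    ⟨G.twoSubAdj_nonpos _ _ h, G.twoSubAdj_nonpos _ _ h.symm⟩
  -- The excluded configurations are the extended Dynkin diagrams `Ã₂`, `Ã₃`, `D̃₄`, `D̃₅`, tested
  -- on their null vectors; any additional edges only lower the form.
  have h3 : ∀ a b c, G.Adj a b → G.Adj b c → ¬ G.Adj a c := by
    intro a b c hab hbc hac
    apply small ![a, b, c] ![1, 1, 1] (by norm_num) (by norm_num [Fin.sum_univ_succ])
    simp [Fin.sum_univ_succ, self, adj hab, adj hbc, adj hac]
    norm_num
  have h4 : ∀ a b c d, a ≠ c → b ≠ d → G.Adj a b → G.Adj b c → G.Adj c d → ¬ G.Adj d a := by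
    intro a b c d hac hbd hab hbc hcd hda
    apply small ![a, b, c, d] ![1, 1, 1, 1] (by norm_num) (by norm_num [Fin.sum_univ_succ])
    simp [Fin.sum_univ_succ, self, adj hab, adj hbc, adj hcd, adj hda]
    linarith [nonpos hac, nonpos hbd]
  have nbr : ∀ v m, m ≤ G.degree v → ∃ s, s ⊆ G.neighborFinset v ∧ #s = m := fun v m h =>
    exists_subset_card_eq (by rwa [card_neighborFinset_eq_degree])
  have hd : ∀ v, G.degree v ≤ 3 := by
    intro v
    by_contra! hv
    obtain ⟨s, hs, hsc⟩ := nbr v 4 hv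
    obtain ⟨a, b, c, d, hab, hac, had, hbc, hbd, hcd, rfl⟩ := card_eq_four.1 hsc
    have mem : ∀ x ∈ ({a, b, c, d} : Finset V), G.Adj v x := fun x hx => by simpa using hs hx
    simp only [mem_insert, mem_singleton, forall_eq_or_imp, forall_eq] at mem
    obtain ⟨ha, hb, hc, hd⟩ := mem
    apply small ![v, a, b, c, d] ![2, 1, 1, 1, 1] (by norm_num) (by norm_num [Fin.sum_univ_succ])
    simp [Fin.sum_univ_succ, self, adj ha, adj hb, adj hc, adj hd]
    linarith [nonpos hab, nonpos hac, nonpos had, nonpos hbc, nonpos hbd, nonpos hcd]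
  have hdd : ∀ u v, G.Adj u v → G.degree u = 3 → G.degree v ≠ 3 := by
    intro u v huv hu hv
    have two : ∀ {u v}, G.Adj u v → G.degree u = 3 →
        ∃ a b, a ≠ b ∧ a ≠ v ∧ b ≠ v ∧ G.Adj u a ∧ G.Adj u b := by
      intro u v huv hu
      have : #((G.neighborFinset u).erase v) = 2 := by
        rw [card_erase_of_mem (by simpa using huv), card_neighborFinset_eq_degree, hu]
      obtain ⟨a, b, hab, hs⟩ := card_eq_two.1 this
      have ha : a ∈ (G.neighborFinset u).erase v := by simp [hs]
      have hb : b ∈ (G.neighborFinset u).erase v := by simp [hs]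
      simp only [mem_erase, mem_neighborFinset] at ha hb
      exact ⟨a, b, hab, ha.1, hb.1, ha.2, hb.2⟩
    obtain ⟨a, b, hab, hav, hbv, hua, hub⟩ := two huv hu
    obtain ⟨c, d, hcd, hcu, hdu, hvc, hvd⟩ := two huv.symm hv
    have cross : ∀ {x z}, G.Adj u x → G.Adj v z → x ≠ z := by
      rintro x _ hx hz rfl
      exact h3 u v x huv hz hx
    apply small ![u, v, a, b, c, d] ![2, 2, 1, 1, 1, 1] (by norm_num)
      (by norm_num [Fin.sum_univ_succ])
    simp [Fin.sum_univ_succ, self, adj huv, adj hua, adj hub, adj hvc, adj hvd]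
    linarith [nonpos hab, nonpos hav, nonpos hbv, nonpos hcd, nonpos hcu, nonpos hdu,
      nonpos (cross hua hvc), nonpos (cross hua hvd), nonpos (cross hub hvc),
      nonpos (cross hub hvd)]
  have h7 := rank_twoSubAdj_ge_of_sparse h3 h4 hd hdd
  have h8 : (G.twoSubAdj.rank : ℝ) ≤ (onesAdd G.twoSubAdj).rank + 1 := by
    exact_mod_cast rank_le_rank_onesAdd_add_one G.twoSubAdj
  apply hcon
  linarith

end GraphRank

end SimpleGraph

/-! ### Degree bounds from a large independent set. -/

namespace SimpleGraph

section DegreeBound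

set_option linter.unusedSectionVars false

variable {V : Type*} [Fintype V] [DecidableEq V] {G : SimpleGraph V} [DecidableRel G.Adj]

theorem twoSubAdj_mulVec_apply (z : V → ℝ) (i : V) :
    (G.twoSubAdj *ᵥ z) i = 2 * z i - (G.adjMatrix ℝ *ᵥ z) i := by
  simp [twoSubAdj, sub_mulVec, smul_mulVec]

/-- Eliminating the coordinates in an independent set `I` from the form `J + 2 (2 I - A)`. -/
theorem schur_complement_indepSet
    (hpos : ∀ z : V → ℝ, 0 ≤ (∑ i, z i) ^ 2 + 2 * (z ⬝ᵥ G.twoSubAdj *ᵥ z))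
    {I : Finset V} (hI : ∀ i ∈ I, ∀ j ∈ I, ¬ G.Adj i j) {z : V → ℝ} (hz : ∀ i ∈ I, z i = 0) :
    0 ≤ 4 * ∑ v, z v ^ 2 - ∑ i ∈ I, (G.adjMatrix ℝ *ᵥ z) i ^ 2 - 2 * (z ⬝ᵥ G.adjMatrix ℝ *ᵥ z)
      + (∑ v, (∑ i ∈ I, G.adjMatrix ℝ i v + 2) * z v) ^ 2 / (#I + 4) := by
  set n := G.adjMatrix ℝ *ᵥ z with hn
  set U := ∑ v, (∑ i ∈ I, G.adjMatrix ℝ i v + 2) * z v with hU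
  have ha : (0 : ℝ) < #I + 4 := by positivity
  -- The minimiser over the coordinates in `I` is `n i / 2 - τ`, where `4 τ` is the resulting total
  -- coordinate sum.
  obtain ⟨τ, hτ⟩ : ∃ τ : ℝ, U = 2 * (#I + 4) * τ := ⟨U / (2 * (#I + 4)), by field_simp⟩
  let w : V → ℝ := fun i => if i ∈ I then n i / 2 - τ else 0
  have hsumw : ∀ c : V → ℝ, ∑ i, w i * c i = ∑ i ∈ I, (n i / 2 - τ) * c i := fun c => by
    simp only [w, ite_mul, zero_mul, sum_ite_mem, univ_inter]
  have hwM : w ⬝ᵥ G.twoSubAdj *ᵥ z = ∑ i ∈ I, (n i / 2 - τ) * (-n i) := by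
    rw [dotProduct, hsumw]
    refine sum_congr rfl fun i hi => ?_
    rw [twoSubAdj_mulVec_apply, hz i hi, hn]
    ring
  have hww : w ⬝ᵥ G.twoSubAdj *ᵥ w = ∑ i ∈ I, (n i / 2 - τ) * (2 * (n i / 2 - τ)) := by
    rw [dotProduct, hsumw]
    refine sum_congr rfl fun i hi => ?_
    have h0 : (G.adjMatrix ℝ *ᵥ w) i = 0 := by
      rw [mulVec, dotProduct]
      refine sum_eq_zero fun j _ => ?_
      by_cases hj : j ∈ I
      · simp [adjMatrix_apply, hI i hi j hj]
      · simp [w, hj]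
    rw [twoSubAdj_mulVec_apply, h0, sub_zero]
    simp [w, hi]
  have hzz : z ⬝ᵥ G.twoSubAdj *ᵥ z = 2 * ∑ v, z v ^ 2 - z ⬝ᵥ n := by
    simp only [dotProduct, twoSubAdj_mulVec_apply, ← hn, mul_sub, sum_sub_distrib, mul_sum]
    congr 1
    exact sum_congr rfl fun i _ => by ring
  have hsn : ∑ i ∈ I, n i + 2 * ∑ v, z v = U := by
    simp only [hU, add_mul, sum_add_distrib, hn, mulVec, dotProduct, sum_mul, mul_sum]
    rw [sum_comm]
  have hsw : ∑ i, w i = (∑ i ∈ I, n i) / 2 - #I * τ := by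
    have := hsumw fun _ => 1
    simp only [mul_one] at this
    rw [this, sum_sub_distrib, sum_div, sum_const, nsmul_eq_mul]
  have h := hpos (z + (1 : ℝ) • w)
  rw [quadForm_add_smul G.twoSubAdj_isSymm, hwM, hww, hzz] at h
  simp only [Pi.add_apply, Pi.smul_apply, smul_eq_mul, one_mul, sum_add_distrib, hsw] at h
  have e1 : ∑ i ∈ I, (n i / 2 - τ) * (-n i) = -(∑ i ∈ I, n i ^ 2) / 2 + τ * ∑ i ∈ I, n i := by
    rw [mul_sum, ← sum_neg_distrib, sum_div, ← sum_add_distrib]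
    exact sum_congr rfl fun i _ => by ring
  have e2 : ∑ i ∈ I, (n i / 2 - τ) * (2 * (n i / 2 - τ))
      = (∑ i ∈ I, n i ^ 2) / 2 - 2 * τ * ∑ i ∈ I, n i + 2 * #I * τ ^ 2 := by
    have : ∑ i ∈ I, (2 * τ ^ 2) = 2 * #I * τ ^ 2 := by
      rw [sum_const, nsmul_eq_mul]; ring
    rw [← this, mul_sum, sum_div, ← sum_sub_distrib, ← sum_add_distrib]
    exact sum_congr rfl fun i _ => by ring
  have e3 : ∑ v, z v + ((∑ i ∈ I, n i) / 2 - #I * τ) = 4 * τ := by linarith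
  have e4 : U ^ 2 / (#I + 4) = 4 * (#I + 4) * τ ^ 2 := by
    rw [hτ]; field_simp; ring
  rw [e1, e2, e3] at h
  rw [e4]
  linarith

variable {I : Finset V}

theorem sum_adjMatrix_col_eq_card (v : V) :
    ∑ i ∈ I, G.adjMatrix ℝ i v = #{i ∈ I | G.Adj v i} := by
  simp [adjMatrix_apply, G.adj_comm]

theorem card_adj_indepSet_le_four
    (hpos : ∀ z : V → ℝ, 0 ≤ (∑ i, z i) ^ 2 + 2 * (z ⬝ᵥ G.twoSubAdj *ᵥ z))
    (hI : ∀ i ∈ I, ∀ j ∈ I, ¬ G.Adj i j) (hcard : #I = 49) {x : V} (hx : x ∉ I)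
    (hk : #{i ∈ I | G.Adj x i} ≤ 24) : #{i ∈ I | G.Adj x i} ≤ 4 := by
  have h := schur_complement_indepSet hpos hI (z := Pi.single x 1) (fun i hi => by
    rw [Pi.single_eq_of_ne]; rintro rfl; exact hx hi)
  have e1 : ∑ v, (Pi.single x 1 : V → ℝ) v ^ 2 = 1 := by
    simp [Pi.single_apply]
  have e2 : ∑ i ∈ I, (G.adjMatrix ℝ *ᵥ Pi.single x 1) i ^ 2 = ∑ i ∈ I, G.adjMatrix ℝ i x := by
    refine sum_congr rfl fun i _ => ?_
    rw [mulVec_single_one, col_apply, adjMatrix_apply]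
    split_ifs <;> norm_num
  have e3 : (Pi.single x 1 : V → ℝ) ⬝ᵥ G.adjMatrix ℝ *ᵥ Pi.single x 1 = 0 := by
    rw [single_one_dotProduct, mulVec_single_one, col_apply]; simp
  have e4 : ∑ v, (∑ i ∈ I, G.adjMatrix ℝ i v + 2) * (Pi.single x 1 : V → ℝ) v
      = ∑ i ∈ I, G.adjMatrix ℝ i x + 2 := by
    simp [Pi.single_apply]
  rw [e1, e2, e3, e4, sum_adjMatrix_col_eq_card, hcard] at h
  generalize #{i ∈ I | G.Adj x i} = k at h hk
  by_contra! h5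
  have h5' : (5 : ℝ) ≤ k := by exact_mod_cast h5
  have hk' : (k : ℝ) ≤ 24 := by exact_mod_cast hk
  have : ((k : ℝ) + 2) ^ 2 / ((49 : ℕ) + 4) = (k + 2) ^ 2 / 53 := by norm_num
  rw [this] at h
  -- The inequality is `0 ≤ 4 - k + (k + 2)² / 53`; the right side is convex in `k` and negative at
  -- 5 and at 24.
  nlinarith

/-- The degree of a vertex of a large independent set. -/
theorem degree_le_six_of_mem
    (hpos : ∀ z : V → ℝ, 0 ≤ (∑ i, z i) ^ 2 + 2 * (z ⬝ᵥ G.twoSubAdj *ᵥ z))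
    (hI : ∀ i ∈ I, ∀ j ∈ I, ¬ G.Adj i j) (hcard : #I = 49)
    (hk : ∀ x ∉ I, #{i ∈ I | G.Adj x i} ≤ 4) {x : V} (hx : x ∈ I) : G.degree x ≤ 6 := by
  by_contra! hdeg
  obtain ⟨Y, hY, hYc⟩ := exists_subset_card_eq (s := G.neighborFinset x) (n := 7)
    (by rw [card_neighborFinset_eq_degree]; omega)
  have hYx : ∀ y ∈ Y, G.Adj x y := fun y hy => by simpa using hY hy
  have hYI : ∀ y ∈ Y, y ∉ I := fun y hy hyI => hI x hx y hyI (hYx y hy)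
  let z : V → ℝ := fun v => if v ∈ Y then 1 else 0
  have hlin : ∀ c : V → ℝ, ∑ v, c v * z v = ∑ v ∈ Y, c v := fun c => by
    simp [z]
  have hn : ∀ i, (G.adjMatrix ℝ *ᵥ z) i = #{y ∈ Y | G.Adj i y} := fun i => by
    rw [mulVec, dotProduct, hlin]; simp [adjMatrix_apply]
  have h := schur_complement_indepSet hpos hI (z := z) (fun i hi => by
    have : i ∉ Y := fun hy => hYI i hy hi
    simp [z, this])
  have e1 : ∑ v, z v ^ 2 = 7 := by simp [z, hYc]
  have e3 : 0 ≤ z ⬝ᵥ G.adjMatrix ℝ *ᵥ z := by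
    rw [dotProduct_comm, dotProduct, hlin]
    exact sum_nonneg fun v _ => by rw [hn]; positivity
  set K := ∑ y ∈ Y, ∑ i ∈ I, G.adjMatrix ℝ i y with hK
  have e4 : ∑ v, (∑ i ∈ I, G.adjMatrix ℝ i v + 2) * z v = K + 14 := by
    rw [hlin, sum_add_distrib, ← hK, sum_const, hYc, nsmul_eq_mul]; push_cast; ring
  -- Squares of counts dominate the counts, and the vertex `x`, adjacent to all of `Y`, yields the
  -- surplus `49 - 7 = 42`.
  have e2 : K + 42 ≤ ∑ i ∈ I, (G.adjMatrix ℝ *ᵥ z) i ^ 2 := by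
    have hK' : K = ∑ i ∈ I, (#{y ∈ Y | G.Adj i y} : ℝ) := by
      rw [hK, sum_comm]
      exact sum_congr rfl fun i _ => by simp [adjMatrix_apply]
    have h42 : (42 : ℝ) = ∑ i ∈ I, if i = x then (42 : ℝ) else 0 := by simp [hx]
    rw [hK', h42, ← sum_add_distrib]
    refine sum_le_sum fun i _ => ?_
    rw [hn]
    split_ifs with hix
    · have : #{y ∈ Y | G.Adj i y} = 7 := by
        rw [filter_true_of_mem fun y hy => hix ▸ hYx y hy, hYc]
      rw [this]; norm_num
    · rw [add_zero]; exact_mod_cast Nat.le_self_pow two_ne_zero _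
  have hK0 : 0 ≤ K := sum_nonneg fun y _ => by rw [sum_adjMatrix_col_eq_card]; exact Nat.cast_nonneg _
  have hK28 : K ≤ 28 := by
    have : K ≤ ∑ y ∈ Y, (4 : ℝ) := sum_le_sum fun y hy => by
      rw [sum_adjMatrix_col_eq_card]; exact_mod_cast hk y (hYI y hy)
    rw [sum_const, hYc] at this
    norm_num at this
    exact this
  have e5 : (K + 14) ^ 2 / ((#I : ℝ) + 4) = (K + 14) ^ 2 / 53 := by rw [hcard]; norm_num
  rw [e1, e4, e5] at h
  nlinarith

/-- The degree of a vertex outside a large independent set. -/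
theorem degree_le_six_of_notMem
    (hpos : ∀ z : V → ℝ, 0 ≤ (∑ i, z i) ^ 2 + 2 * (z ⬝ᵥ G.twoSubAdj *ᵥ z))
    (hI : ∀ i ∈ I, ∀ j ∈ I, ¬ G.Adj i j) (hcard : #I = 49)
    (hk : ∀ x ∉ I, #{i ∈ I | G.Adj x i} ≤ 4) {x : V} (hx : x ∉ I) : G.degree x ≤ 6 := by
  by_contra! hdeg
  have hkx := hk x hx
  set k := #{i ∈ I | G.Adj x i} with hkdef
  have hout : 7 - k ≤ #{y ∈ G.neighborFinset x | y ∉ I} := by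
    have h1 := card_filter_add_card_filter_not (s := G.neighborFinset x) (fun y => y ∈ I)
    rw [card_neighborFinset_eq_degree] at h1
    have h2 : {y ∈ G.neighborFinset x | y ∈ I} = {i ∈ I | G.Adj x i} := by
      ext y; simp [and_comm]
    rw [h2] at h1
    omega
  obtain ⟨Y, hY, hYc⟩ := exists_subset_card_eq hout
  have hYx : ∀ y ∈ Y, G.Adj x y := fun y hy => by simpa using (mem_filter.1 (hY hy)).1
  have hYI : ∀ y ∈ Y, y ∉ I := fun y hy => (mem_filter.1 (hY hy)).2
  have hxY : x ∉ Y := fun h => G.irrefl (hYx x h)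
  have ht : (#Y : ℝ) = 7 - k := by
    rw [hYc, Nat.cast_sub (by omega)]; norm_num
  -- With weight 2 at `x` and 1 on `7 - k` outside neighbours, `k` cancels from the final
  -- inequality.
  let z : V → ℝ := fun v => (if v = x then 2 else 0) + if v ∈ Y then 1 else 0
  have hlin : ∀ c : V → ℝ, ∑ v, c v * z v = 2 * c x + ∑ v ∈ Y, c v := fun c => by
    simp [z, mul_add, sum_add_distrib, mul_comm]
  have hn : ∀ i, (G.adjMatrix ℝ *ᵥ z) i = 2 * G.adjMatrix ℝ i x + #{y ∈ Y | G.Adj i y} :=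
    fun i => by
      rw [mulVec, dotProduct, hlin]; simp [adjMatrix_apply]
  have h := schur_complement_indepSet hpos hI (z := z) (fun i hi => by
    have h1 : i ∉ Y := fun hy => hYI i hy hi
    have h2 : i ≠ x := by rintro rfl; exact hx hi
    simp [z, h1, h2])
  have hzx : z x = 2 := by simp [z, hxY]
  have hzY : ∀ y ∈ Y, z y = 1 := fun y hy => by
    have : y ≠ x := by rintro rfl; exact hxY hy
    simp [z, this, hy]
  have e1 : ∑ v, z v ^ 2 = 4 + #Y := by
    simp only [sq]
    rw [hlin, hzx, sum_congr rfl hzY]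
    norm_num
  have e3 : 4 * (#Y : ℝ) ≤ z ⬝ᵥ G.adjMatrix ℝ *ᵥ z := by
    rw [dotProduct_comm, dotProduct, hlin]
    have h1 : (G.adjMatrix ℝ *ᵥ z) x = #Y := by
      rw [hn, filter_true_of_mem hYx]; simp
    have h2 : ∑ y ∈ Y, (2 : ℝ) ≤ ∑ y ∈ Y, (G.adjMatrix ℝ *ᵥ z) y := sum_le_sum fun y hy => by
      rw [hn, adjMatrix_apply, if_pos (hYx y hy).symm]
      linarith [Nat.cast_nonneg (α := ℝ) #{y' ∈ Y | G.Adj y y'}]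
    rw [sum_const, nsmul_eq_mul] at h2
    rw [h1]
    linarith
  set K := ∑ y ∈ Y, ∑ i ∈ I, G.adjMatrix ℝ i y with hK
  have e4 : ∑ v, (∑ i ∈ I, G.adjMatrix ℝ i v + 2) * z v = 2 * (k + 2) + (K + 2 * #Y) := by
    rw [hlin, sum_add_distrib, sum_const, sum_adjMatrix_col_eq_card, nsmul_eq_mul]; ring
  have e2 : 4 * k + K ≤ ∑ i ∈ I, (G.adjMatrix ℝ *ᵥ z) i ^ 2 := by
    have hK' : K = ∑ i ∈ I, (#{y ∈ Y | G.Adj i y} : ℝ) := by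
      rw [hK, sum_comm]
      exact sum_congr rfl fun i _ => by simp [adjMatrix_apply]
    rw [hK', hkdef, ← sum_adjMatrix_col_eq_card, mul_sum, ← sum_add_distrib]
    refine sum_le_sum fun i _ => ?_
    rw [hn, adjMatrix_apply]
    have h1 : (#{y ∈ Y | G.Adj i y} : ℝ) ≤ #{y ∈ Y | G.Adj i y} ^ 2 := by
      exact_mod_cast Nat.le_self_pow two_ne_zero _
    have h2 : (0 : ℝ) ≤ #{y ∈ Y | G.Adj i y} := Nat.cast_nonneg _
    split_ifs <;> nlinarith
  have hK0 : 0 ≤ K := sum_nonneg fun y _ => by rw [sum_adjMatrix_col_eq_card]; exact Nat.cast_nonneg _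
  have hK28 : K ≤ 28 := by
    have : K ≤ ∑ y ∈ Y, (4 : ℝ) := sum_le_sum fun y hy => by
      rw [sum_adjMatrix_col_eq_card]; exact_mod_cast hk y (hYI y hy)
    rw [sum_const, nsmul_eq_mul, ht] at this
    linarith [Nat.cast_nonneg (α := ℝ) k]
  have e5 : 2 * ((k : ℝ) + 2) + (K + 2 * #Y) = K + 18 := by rw [ht]; ring
  have e6 : (K + 18) ^ 2 / ((#I : ℝ) + 4) = (K + 18) ^ 2 / 53 := by rw [hcard]; norm_num
  rw [e1, e4, e5, e6, ht] at h
  rw [ht] at e3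
  -- What remains is `0 ≤ -12 - K + (K + 18)² / 53`, false on `[0, 28]` by convexity. At `K = 28` it
  -- is `2116 / 53 < 40`, which would fail with 52 in place of 53; this is where size 49 is needed.
  nlinarith

end DegreeBound

end SimpleGraph

/-! ### Switching, and the choice of a good graph in the class. -/

namespace SeidelMatrix

section Switching

set_option linter.unusedSectionVars false

variable {V : Type*} [Fintype V] [DecidableEq V]

theorem posSemidef_of_isLeast_eigenvalue {S : Matrix V V ℝ} (hS : S.IsSymm)
    (hmin : IsLeast {μ : ℝ | Module.End.HasEigenvalue (Matrix.toLin' S) μ} (-5)) :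
    (S + (5 : ℝ) • (1 : Matrix V V ℝ)).PosSemidef := by
  have hX : (S + (5 : ℝ) • (1 : Matrix V V ℝ)).IsHermitian :=
    IsSymm.add hS (isSymm_one.smul (5 : ℝ))
  rw [hX.posSemidef_iff_eigenvalues_nonneg]
  intro i
  have h := hX.mulVec_eigenvectorBasis i
  set e := hX.eigenvalues i
  set v : V → ℝ := ⇑(hX.eigenvectorBasis i) with hv
  have hne : v ≠ 0 := by
    intro h0
    apply hX.eigenvectorBasis.orthonormal.ne_zero i
    ext j
    exact congrFun h0 j
  have hev : Module.End.HasEigenvalue (Matrix.toLin' S) (e - 5) := by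
    refine Module.End.hasEigenvalue_of_hasEigenvector (x := v)
      ⟨Module.End.mem_eigenspace_iff.2 ?_, hne⟩
    rw [add_mulVec, smul_mulVec, one_mulVec] at h
    rw [toLin'_apply, sub_smul, ← h]
    simp
  have := hmin.2 hev
  simp only [Pi.zero_apply]
  linarith

/-- The sign `1` or `-1` of a vertex in `signMatrix U`. -/
noncomputable def sign (U : Finset V) (i : V) : ℝ := if i ∈ U then 1 else -1

theorem sign_mul_self (U : Finset V) (i : V) : sign U i * sign U i = 1 := by
  unfold sign; split_ifs <;> norm_num

theorem signMatrix_eq (U : Finset V) :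
    signMatrix (U : Set V) = diagonal (sign U) := by
  simp [signMatrix, sign]

theorem switch_apply (S : Matrix V V ℝ) (U : Finset V) (i j : V) :
    switch S (U : Set V) i j = sign U i * S i j * sign U j := by
  rw [switch, signMatrix_eq, mul_diagonal, diagonal_mul]

theorem switch_add_smul_one (S : Matrix V V ℝ) (U : Finset V) (c : ℝ) :
    switch S (U : Set V) + c • 1 = diagonal (sign U) * (S + c • 1) * diagonal (sign U) := by
  ext i j
  rw [mul_diagonal, diagonal_mul, Matrix.add_apply, switch_apply, Matrix.add_apply]
  by_cases h : i = j
  · subst h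
    simp only [Matrix.smul_apply, one_apply_eq, smul_eq_mul]
    linear_combination -c * sign_mul_self U i
  · simp [h]

theorem rank_switch_add_smul_one (S : Matrix V V ℝ) (U : Finset V) (c : ℝ) :
    (switch S (U : Set V) + c • 1).rank = (S + c • 1).rank := by
  have hdet : IsUnit (diagonal (sign U)).det := by
    rw [det_diagonal, isUnit_iff_ne_zero, prod_ne_zero_iff]
    intro i _ h0
    simpa [h0] using sign_mul_self U i
  rw [switch_add_smul_one, rank_mul_eq_left_of_isUnit_det _ _ hdet,
    rank_mul_eq_right_of_isUnit_det _ _ hdet]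

theorem posSemidef_switch_add_smul_one {S : Matrix V V ℝ} {c : ℝ} (h : (S + c • 1).PosSemidef)
    (U : Finset V) : (switch S (U : Set V) + c • 1).PosSemidef := by
  rw [switch_add_smul_one]
  simpa using h.mul_mul_conjTranspose_same (diagonal (sign U))

theorem IsSeidel.eq_one_of_ne_neg_one {S : Matrix V V ℝ} (hS : IsSeidel S) {i j : V}
    (hij : i ≠ j) (h : S i j ≠ -1) : S i j = 1 :=
  (hS.offDiag i j hij).resolve_right h

open Classical in
theorem add_five_eq_onesAdd {S : Matrix V V ℝ} (hS : IsSeidel S) :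
    S + (5 : ℝ) • 1 = onesAdd (graph S hS).twoSubAdj := by
  ext i j
  by_cases hij : i = j
  · subst hij
    simp [onesAdd, SimpleGraph.twoSubAdj_self, hS.diag]
    norm_num
  · have hadj : (graph S hS).Adj i j ↔ S i j = -1 := Iff.rfl
    rcases hS.offDiag i j hij with h | h <;>
      simp [onesAdd, SimpleGraph.twoSubAdj_of_ne _ hij, hadj, h, hij] <;> norm_num

/-- An independent set of the switching graph becomes, after a suitable switching, an independent
set in which every other vertex has at most half of its possible neighbours. -/
theorem exists_switch_indepSet {S : Matrix V V ℝ} (hS : IsSeidel S)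
    {m : ℕ} (hm : 3 ≤ m) (hα : m ≤ classIndepNum S hS) :
    ∃ U I : Finset V, #I = m ∧
      (∀ i ∈ I, ∀ j ∈ I, i ≠ j → switch S (U : Set V) i j = 1) ∧
      ∀ x ∉ I, 0 ≤ ∑ i ∈ I, switch S (U : Set V) x i := by
  classical
  obtain ⟨T', hT'⟩ := (switchingGraph S hS).exists_isNIndepSet_indepNum
  obtain ⟨T, hTT', hTc⟩ := exists_subset_card_eq (s := T') (n := m) (by rw [hT'.card_eq]; exact hα)
  have hT : ∀ p ∈ T, ∀ q ∈ T, p ≠ q → double S p q = 1 := fun p hp q hq hpq =>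
    hS.double.eq_one_of_ne_neg_one hpq
      (hT'.isIndepSet (mem_coe.2 (hTT' hp)) (mem_coe.2 (hTT' hq)) hpq)
  -- The two copies of a vertex are nonadjacent, but any third vertex of `T` sees them with opposite
  -- signs; hence `m ≥ 3`.
  have hnb : ∀ i, Sum.inl i ∈ T → Sum.inr i ∉ T := by
    intro i hl hr
    have : 0 < #((T.erase (Sum.inl i)).erase (Sum.inr i)) := by
      rw [card_erase_of_mem (by simp [hr]), card_erase_of_mem hl]; omega
    obtain ⟨p, hp⟩ := card_pos.1 this
    simp only [mem_erase] at hp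
    have h1 := hT _ hl p hp.2.2 hp.2.1.symm
    have h2 := hT _ hr p hp.2.2 hp.1.symm
    rcases p with j | j
    · have hij : i ≠ j := fun h => hp.2.1 (by rw [h])
      simp only [double, fromBlocks_apply₁₁, fromBlocks_apply₂₁, Matrix.add_apply,
        Matrix.neg_apply, one_apply_ne hij] at h1 h2
      linarith
    · have hij : i ≠ j := fun h => hp.1 (by rw [h])
      simp only [double, fromBlocks_apply₁₂, fromBlocks_apply₂₂, Matrix.add_apply,
        Matrix.neg_apply, one_apply_ne hij] at h1 h2
      linarith
  let I : Finset V := T.image (Sum.elim id id)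
  have hI : ∀ i, i ∈ I ↔ Sum.inl i ∈ T ∨ Sum.inr i ∈ T := fun i => by simp [I]
  let ε : V → ℝ := fun i => if Sum.inl i ∈ T then 1 else -1
  -- On `I` the sign records which copy lies in `T`; each outside vertex is signed to make its row
  -- sum over `I` nonnegative.
  let U : Finset V := {x | if x ∈ I then Sum.inl x ∈ T else 0 ≤ ∑ i ∈ I, S x i * ε i}
  have hU : ∀ i ∈ I, sign U i = ε i := fun i hi => by simp [sign, U, hi, ε]
  refine ⟨U, I, ?_, ?_, ?_⟩
  · rw [← hTc]
    refine card_image_of_injOn fun p hp q hq hpq => ?_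
    rcases p with i | i <;> rcases q with j | j <;>
      simp only [Sum.elim_inl, Sum.elim_inr, id] at hpq <;> subst hpq
    · rfl
    · exact absurd hq (hnb i hp)
    · exact absurd hp (hnb i hq)
    · rfl
  · intro i hi j hj hij
    rw [switch_apply, hU i hi, hU j hj]
    have hr : ∀ i, Sum.inr i ∈ T → Sum.inl i ∉ T := fun i h h' => hnb i h' h
    rcases (hI i).1 hi with h1 | h1 <;> rcases (hI j).1 hj with h2 | h2 <;>
      have h := hT _ h1 _ h2 (by simp [hij]) <;>
      simp only [double, fromBlocks_apply₁₁, fromBlocks_apply₁₂, fromBlocks_apply₂₁,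
        fromBlocks_apply₂₂, Matrix.add_apply, Matrix.neg_apply, one_apply_ne hij] at h
    · simp [ε, h1, h2, h]
    · simp only [ε, h1, hr j h2, if_true, if_false]; linarith
    · simp only [ε, hr i h1, h2, if_true, if_false]; linarith
    · simp [ε, hr i h1, hr j h2, h]
  · intro x hx
    have : ∑ i ∈ I, switch S (U : Set V) x i = sign U x * ∑ i ∈ I, S x i * ε i := by
      rw [mul_sum]
      refine sum_congr rfl fun i hi => ?_
      rw [switch_apply, hU i hi, mul_assoc]
    rw [this]
    by_cases h : 0 ≤ ∑ i ∈ I, S x i * ε i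
    · simp [sign, U, hx, h]
    · simp only [sign, U, hx, h, mem_filter, mem_univ, if_false, and_false]
      linarith

end Switching

end SeidelMatrix

/-! ### The main theorem. -/

open SeidelMatrix in
theorem mainTheorem3 (n : ℕ) (hn : 277 ≤ n) (S : Matrix (Fin n) (Fin n) ℝ)
    (hS : SeidelMatrix.IsSeidel S)
    (hmin : IsLeast {μ : ℝ | Module.End.HasEigenvalue (Matrix.toLin' S) μ} (-5))
    (hα : 49 ≤ SeidelMatrix.classIndepNum S hS) :
    2 * (n : ℝ) / 3 + 1 ≤ ((S + (5 : ℝ) • (1 : Matrix (Fin n) (Fin n) ℝ)).rank : ℝ) ∧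
      ∃ G ∈ SeidelMatrix.switchingClass S hS, ∀ v, (G.neighborSet v).ncard ≤ 6 := by
  classical
  obtain ⟨U, I, hcard, hI, hout⟩ := exists_switch_indepSet hS (by norm_num) hα
  have hS' := hS.switch (U : Set (Fin n))
  set G := graph (switch S (U : Set (Fin n))) hS' with hG
  have hadj : ∀ i j, G.Adj i j ↔ switch S (U : Set (Fin n)) i j = -1 := fun i j => Iff.rfl
  have hpsd := posSemidef_switch_add_smul_one (posSemidef_of_isLeast_eigenvalue hS.symm hmin) U
  have hrank := rank_switch_add_smul_one S U 5
  rw [add_five_eq_onesAdd hS', ← hG] at hpsd hrank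
  have hpos : ∀ z : Fin n → ℝ, 0 ≤ (∑ i, z i) ^ 2 + 2 * (z ⬝ᵥ G.twoSubAdj *ᵥ z) := fun z => by
    rw [← onesAdd_quadForm]
    exact hpsd.dotProduct_mulVec_nonneg z
  have hIG : ∀ i ∈ I, ∀ j ∈ I, ¬ G.Adj i j := fun i hi j hj h => by
    have h1 := hI i hi j hj h.ne
    rw [(hadj i j).1 h] at h1
    norm_num at h1
  have hk : ∀ x ∉ I, #{i ∈ I | G.Adj x i} ≤ 4 := fun x hx => by
    refine SimpleGraph.card_adj_indepSet_le_four hpos hIG hcard hx ?_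
    have h1 : ∑ i ∈ I, switch S (U : Set (Fin n)) x i
        = ∑ i ∈ I, (1 - 2 * if G.Adj x i then (1 : ℝ) else 0) := sum_congr rfl fun i hi => by
      have hne : x ≠ i := by rintro rfl; exact hx hi
      split_ifs with h
      · rw [(hadj x i).1 h]; norm_num
      · rw [hS'.eq_one_of_ne_neg_one hne h]; norm_num
    have h2 := hout x hx
    rw [h1, sum_sub_distrib, ← mul_sum, sum_boole, sum_const, hcard, nsmul_eq_mul] at h2
    have h3 : (2 * #{i ∈ I | G.Adj x i} : ℝ) ≤ 49 := by
      norm_num at h2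
      linarith
    have h4 : 2 * #{i ∈ I | G.Adj x i} ≤ 49 := by exact_mod_cast h3
    omega
  have hdeg : ∀ v, G.degree v ≤ 6 := fun v => by
    by_cases hv : v ∈ I
    · exact SimpleGraph.degree_le_six_of_mem hpos hIG hcard hk hv
    · exact SimpleGraph.degree_le_six_of_notMem hpos hIG hcard hk hv
  constructor
  · have h := SimpleGraph.rank_onesAdd_ge_of_degree_le (by rw [Fintype.card_fin]; omega) hdeg hpos
    rwa [hrank, Fintype.card_fin] at h
  · refine ⟨G, ⟨U, rfl⟩, fun v => ?_⟩
    rw [← Nat.card_coe_set_eq, Nat.card_eq_fintype_card, SimpleGraph.card_neighborSet_eq_degree]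
    exact hdeg v
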